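/- Let $N$ players $i=1,\dots,N$ choose Hermitian matrices $X_i$ of size $M_i$ (over $\mathbb{C}$, or real symmetric matrices over $\mathbb{R}$), with feasible sets $$\mathcal{X}_i=\{X_i\succeq 0:\ \|X_i\|\le A_i\},\qquad A_i>0,$$ where $\|X_i\|=\sum_m|\mathrm{eig}_m(X_i)|$ is the nuclear norm, and let $\mathcal{X}=\prod_i\mathcal{X}_i$. Let $u_i:\mathcal{X}\to\mathbb{R}$ be the utility of player $i$. Assume that $u_i(X_i;X_{-i})$ is concave and differentiable in $X_i\in\mathcal{X}_i$ for every fixed $X_{-i}$, and that the individual gradients $V_i(X)=\nabla_{X_i}u_i(X)$ (Hermitian matrices, taken with respect to the trace inner product $\langle A,B\rangle=\mathrm{tr}(AB)$ and within the feasible sets at boundary points) are continuously differentiable on $\mathcal{X}$. A profile $X^*\in\mathcal{X}$ is a Nash equilibrium if $u_i(X^*)\ge u_i(X_i;X^*_{-i})$ for all $i$ and all $X_i\in\mathcal{X}_i$; it is isolated if it is the only Nash equilibrium in some neighbourhood of itself. A profile $X^*\in\mathcal{X}$ is (locally) stable if $$\sum_i \mathrm{tr}\big[(X_i-X_i^*)V_i(X)\big]\le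 0,\quad\text{with equality if and only if } X=X^*,$$ for all $X\in\mathcal{X}$ sufficiently close to $X^*$, and globally stable if this holds for all $X\in\mathcal{X}$. The Hessian of the game is the block matrix $D(X)=(D_{ij}(X))_{i,j}$, $$D_{ij}(X)=\tfrac12\nabla_{X_i}\nabla_{X_j}u_j(X)+\tfrac12\big[\nabla_{X_j}\nabla_{X_i}u_i(X)\big]^\dagger,$$ where $\nabla_{X_i}\nabla_{X_j}u_j=\nabla_{X_i}V_j$ has its rows indexed by the coordinates of $X_i$, and $D(X)\prec0$ means that $\sum_{i,j}\langle H_i,D_{ij}(X)H_j\rangle<0$ for every nonzero tuple $H=(H_1,\dots,H_N)$ of Hermitian matrices $H_i$ of size $M_i$. Then: 1. If $D(X)\prec0$ for all $X\in\mathcal{X}$, the game has a Nash equilibrium, it is unique, and it is globally stable. 2. If $X^*$ is a Nash equilibrium and $D(X^*)\prec 0$, then $X^*$ is locally stable and isolated. -/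

import Mathlib

open scoped Topology InnerProductSpace ComplexOrder

noncomputable section

/-- The real vector space of Hermitian `n × n` matrices over `𝕜 = ℝ` or `𝕜 = ℂ`. -/
def HermMat (𝕜 : Type*) [RCLike 𝕜] (n : Type*) : Type _ :=
  selfAdjoint.submodule ℝ (Matrix n n 𝕜)

namespace HermMat

variable {𝕜 : Type*} [RCLike 𝕜] {n : Type*}

instance : AddCommGroup (HermMat 𝕜 n) :=
  inferInstanceAs (AddCommGroup (selfAdjoint.submodule ℝ (Matrix n n 𝕜)))

instance : Module ℝ (HermMat 𝕜 n) :=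
  inferInstanceAs (Module ℝ (selfAdjoint.submodule ℝ (Matrix n n 𝕜)))

/-- The underlying matrix. -/
def mat (X : HermMat 𝕜 n) : Matrix n n 𝕜 := Subtype.val X

theorem isHermitian (X : HermMat 𝕜 n) : X.mat.IsHermitian := Subtype.property X

theorem ext_mat {X Y : HermMat 𝕜 n} (h : X.mat = Y.mat) : X = Y := Subtype.ext h

theorem mat_add (X Y : HermMat 𝕜 n) : (X + Y).mat = X.mat + Y.mat := rfl

theorem mat_smul (r : ℝ) (X : HermMat 𝕜 n) : (r • X).mat = r • X.mat := rfl

theorem mat_zero : (0 : HermMat 𝕜 n).mat = 0 := rfl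

instance [Fintype n] : FiniteDimensional ℝ (HermMat 𝕜 n) :=
  haveI : Module.Finite ℝ (Matrix n n 𝕜) := Module.Finite.trans 𝕜 _
  inferInstanceAs (FiniteDimensional ℝ (selfAdjoint.submodule ℝ (Matrix n n 𝕜)))

/-- The trace inner product `⟪X, Y⟫ = tr (X Y)`; the trace is real for Hermitian `X`, `Y`, see
`HermMat.inner_eq_trace`. -/
@[reducible]
def innerCore (𝕜 : Type*) [RCLike 𝕜] (n : Type*) [Fintype n] :
    InnerProductSpace.Core ℝ (HermMat 𝕜 n) where
  inner X Y := RCLike.re (Matrix.trace (X.mat * Y.mat))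
  conj_inner_symm X Y := by
    simp only [conj_trivial]
    rw [Matrix.trace_mul_comm]
  re_inner_nonneg X := by
    have h := X.isHermitian
    have h1 : 0 ≤ Matrix.trace (X.mat.conjTranspose * X.mat) :=
      (Matrix.posSemidef_conjTranspose_mul_self X.mat).trace_nonneg
    rw [h] at h1
    exact (RCLike.nonneg_iff.mp h1).1
  add_left X Y Z := by
    simp only [mat_add, add_mul, Matrix.trace_add, map_add]
  smul_left X Y r := by
    simp only [mat_smul, Matrix.smul_mul, Matrix.trace_smul, RCLike.smul_re, conj_trivial]
  definite X hX := by
    have h := X.isHermitian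
    have h1 : 0 ≤ Matrix.trace (X.mat.conjTranspose * X.mat) :=
      (Matrix.posSemidef_conjTranspose_mul_self X.mat).trace_nonneg
    have h2 : Matrix.trace (X.mat.conjTranspose * X.mat) = 0 := by
      rw [RCLike.nonneg_iff] at h1
      refine RCLike.ext ?_ ?_
      · rw [h]; simpa using hX
      · simpa using h1.2
    exact ext_mat (Matrix.trace_conjTranspose_mul_self_eq_zero_iff.mp h2)

instance [Fintype n] : NormedAddCommGroup (HermMat 𝕜 n) :=
  @InnerProductSpace.Core.toNormedAddCommGroup ℝ _ _ _ _ (innerCore 𝕜 n)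

instance [Fintype n] : InnerProductSpace ℝ (HermMat 𝕜 n) :=
  InnerProductSpace.ofCore (innerCore 𝕜 n).toCore

instance [Fintype n] : CompleteSpace (HermMat 𝕜 n) :=
  FiniteDimensional.complete ℝ _

theorem inner_def [Fintype n] (X Y : HermMat 𝕜 n) :
    ⟪X, Y⟫_ℝ = RCLike.re (Matrix.trace (X.mat * Y.mat)) := rfl

theorem inner_eq_trace [Fintype n] (X Y : HermMat 𝕜 n) :
    ((⟪X, Y⟫_ℝ : ℝ) : 𝕜) = Matrix.trace (X.mat * Y.mat) := by
  have h : star (Matrix.trace (X.mat * Y.mat)) = Matrix.trace (X.mat * Y.mat) := by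
    rw [← Matrix.trace_conjTranspose, Matrix.conjTranspose_mul, X.isHermitian, Y.isHermitian,
      Matrix.trace_mul_comm]
  rw [inner_def]
  exact RCLike.conj_eq_iff_re.mp h

/-- The nuclear (trace) norm `∑ₘ |eigₘ(X)|`. -/
def nuclearNorm [Fintype n] [DecidableEq n] (X : HermMat 𝕜 n) : ℝ :=
  ∑ m, |X.isHermitian.eigenvalues m|

end HermMat

namespace SemidefGame

variable {𝕜 : Type*} [RCLike 𝕜] {ι : Type*} {n : ι → Type*} [∀ i, Fintype (n i)]

/-- Action profiles (not yet required to be feasible): one Hermitian matrix for every player. -/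
abbrev Profile (𝕜 : Type*) [RCLike 𝕜] {ι : Type*} (n : ι → Type*) : Type _ :=
  ∀ i, HermMat 𝕜 (n i)

/-- The feasible actions `{X ≽ 0 : ‖X‖ ≤ A}` of one player, with the nuclear norm. -/
def feasible (𝕜 : Type*) [RCLike 𝕜] (m : Type*) [Fintype m] [DecidableEq m] (A : ℝ) :
    Set (HermMat 𝕜 m) :=
  {X | X.mat.PosSemidef ∧ X.nuclearNorm ≤ A}

variable [∀ i, DecidableEq (n i)]

/-- The feasible action profiles, i.e. the product of the players' feasible action sets. -/
def profiles (𝕜 : Type*) [RCLike 𝕜] {ι : Type*} (n : ι → Type*) [∀ i, Fintype (n i)]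
    [∀ i, DecidableEq (n i)] (A : ι → ℝ) : Set (Profile 𝕜 n) :=
  {X | ∀ i, X i ∈ feasible 𝕜 (n i) (A i)}

variable [DecidableEq ι]

/-- `X` is a Nash equilibrium of the game with bounds `A` and utilities `u`: it is feasible and no
player gains by a feasible unilateral deviation. -/
def IsNash (A : ι → ℝ) (u : ι → Profile 𝕜 n → ℝ) (X : Profile 𝕜 n) : Prop :=
  X ∈ profiles 𝕜 n A ∧
    ∀ i, ∀ Y ∈ feasible 𝕜 (n i) (A i), u i (Function.update X i Y) ≤ u i X

/-- The individual payoff gradient `Vᵢ(X) = ∇_{Xᵢ} uᵢ(Xᵢ; X₋ᵢ)`, with respect to the trace inner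
product; derivatives at boundary points are taken within the feasible set. -/
def payoffGrad (A : ι → ℝ) (u : ι → Profile 𝕜 n → ℝ) (i : ι) (X : Profile 𝕜 n) :
    HermMat 𝕜 (n i) :=
  gradientWithin (fun Y => u i (Function.update X i Y)) (feasible 𝕜 (n i) (A i)) (X i)

/-- The partial derivative of `Vᵢ` with respect to `Xⱼ`, as a linear map; derivatives at boundary
points are taken within the feasible set. -/
def gradDeriv (A : ι → ℝ) (u : ι → Profile 𝕜 n → ℝ) (i j : ι) (X : Profile 𝕜 n) :
    HermMat 𝕜 (n j) →L[ℝ] HermMat 𝕜 (n i) :=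
  fderivWithin ℝ (fun Y => payoffGrad A u i (Function.update X j Y))
    (feasible 𝕜 (n j) (A j)) (X j)

/-- The `(i, j)` block `½ ∇_{Xᵢ} ∇_{Xⱼ} uⱼ + ½ (∇_{Xⱼ} ∇_{Xᵢ} uᵢ)†` of the game's Hessian, as the
linear map that it defines from the `j`-th to the `i`-th component. The table
`∇_{Xᵢ} ∇_{Xⱼ} uⱼ = ∇_{Xᵢ} Vⱼ` has its rows indexed by `i`, so it is the adjoint of the derivative
of `Vⱼ` in `Xᵢ`; the second summand is the derivative of `Vᵢ` in `Xⱼ`. -/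
def hessianBlock (A : ι → ℝ) (u : ι → Profile 𝕜 n → ℝ) (i j : ι) (X : Profile 𝕜 n) :
    HermMat 𝕜 (n j) →L[ℝ] HermMat 𝕜 (n i) :=
  (1 / 2 : ℝ) • ContinuousLinearMap.adjoint (gradDeriv A u j i X) +
    (1 / 2 : ℝ) • gradDeriv A u i j X

variable [Fintype ι]

/-- `D(X) ≺ 0`: the quadratic form of the block matrix `D(X)` is negative definite. -/
def HessianNegDef (A : ι → ℝ) (u : ι → Profile 𝕜 n → ℝ) (X : Profile 𝕜 n) : Prop :=
  ∀ H : Profile 𝕜 n, H ≠ 0 → ∑ i, ∑ j, ⟪H i, hessianBlock A u i j X (H j)⟫_ℝ < 0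

/-- The trace pairing `tr[(X - X*) V(X)]` of block-diagonal matrices. -/
def stabilityPairing (A : ι → ℝ) (u : ι → Profile 𝕜 n → ℝ) (Xs X : Profile 𝕜 n) : ℝ :=
  ∑ i, ⟪X i - Xs i, payoffGrad A u i X⟫_ℝ

/-- The variational stability inequality for `X*` at `X`: `tr[(X - X*) V(X)] ≤ 0`, with equality
only if `X = X*`. -/
def VS (A : ι → ℝ) (u : ι → Profile 𝕜 n → ℝ) (Xs X : Profile 𝕜 n) : Prop :=
  stabilityPairing A u Xs X ≤ 0 ∧ (stabilityPairing A u Xs X = 0 → X = Xs)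

/-- `X*` is (locally) stable: the stability inequality holds at all feasible profiles close to
`X*`. -/
def IsLocallyStable (A : ι → ℝ) (u : ι → Profile 𝕜 n → ℝ) (Xs : Profile 𝕜 n) : Prop :=
  Xs ∈ profiles 𝕜 n A ∧ ∀ᶠ X in 𝓝[profiles 𝕜 n A] Xs, VS A u Xs X

/-- `X*` is globally stable: the stability inequality holds at all feasible profiles. -/
def IsGloballyStable (A : ι → ℝ) (u : ι → Profile 𝕜 n → ℝ) (Xs : Profile 𝕜 n) : Prop :=
  Xs ∈ profiles 𝕜 n A ∧ ∀ X ∈ profiles 𝕜 n A, VS A u Xs X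

/-- `X*` is isolated: it is the only Nash equilibrium in some neighbourhood of itself. -/
def IsIsolatedNash (A : ι → ℝ) (u : ι → Profile 𝕜 n → ℝ) (Xs : Profile 𝕜 n) : Prop :=
  IsNash A u Xs ∧ ∀ᶠ X in 𝓝 Xs, IsNash A u X → X = Xs

/-- The standing assumptions on the game: the bounds `Aᵢ` are positive, every `uᵢ` is concave and
differentiable in the player's own action, and the individual payoff gradients are continuously
differentiable on the set of feasible profiles, so that the Hessian exists and is continuous. -/
structure IsSmoothConcaveGame (A : ι → ℝ) (u : ι → Profile 𝕜 n → ℝ) : Prop where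
  pos : ∀ i, 0 < A i
  concave : ∀ i, ∀ X ∈ profiles 𝕜 n A,
    ConcaveOn ℝ (feasible 𝕜 (n i) (A i)) (fun Y => u i (Function.update X i Y))
  differentiable : ∀ i, ∀ X ∈ profiles 𝕜 n A,
    DifferentiableOn ℝ (fun Y => u i (Function.update X i Y)) (feasible 𝕜 (n i) (A i))
  contDiff : ∀ i, ContDiffOn ℝ 1 (payoffGrad A u i) (profiles 𝕜 n A)

end SemidefGame

end

/-! The payoff gradients are collected into one linear form, `gradForm`. Since each utility is
concave in the player's own action, Nash equilibria are exactly the solutions of the variational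
inequality `gradForm X* (Y - X*) ≤ 0` over feasible `Y` (`isNash_iff`). The quadratic form of `D(X)`
is that of the derivative of `gradForm`, because symmetrising a form does not change its diagonal
(`sum_inner_hessianBlock`).

If `D` is negative definite everywhere, integrating along segments makes `gradForm` strictly
monotone. A monotone variational inequality on a compact convex set has a solution: Minty's lemma
reduces it to an intersection of closed half-spaces, and finite subfamilies are handled by a minimax
argument on the simplex, without a fixed-point theorem. Adding the inequality at `X*` to strict
monotonicity gives strict stability, which in turn rules out other equilibria.

If `D` is negative definite only at `X*`, coercivity absorbs the Taylor remainder. This gives strict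
monotonicity between `X*` and each nearby feasible `X`, and the same argument then runs locally. -/

/-! ### Monotone operators and variational inequalities. -/

section VariationalInequality

variable {E : Type*} [NormedAddCommGroup E] [NormedSpace ℝ E]

/-- A matrix whose symmetric part has nonpositive entries maps some point of the standard simplex
to a nonpositive vector. -/
theorem exists_stdSimplex_sum_mul_nonpos {κ : Type*} [Fintype κ] [Nonempty κ] (a : κ → κ → ℝ)
    (ha : ∀ k j, a k j + a j k ≤ 0) :
    ∃ w ∈ stdSimplex ℝ κ, ∀ k, ∑ j, w j * a k j ≤ 0 := by
  classical
  let T : (κ → ℝ) →ₗ[ℝ] (κ → ℝ) := Matrix.mulVecLin (Matrix.of a)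
  have hT : ∀ w k, T w k = ∑ j, w j * a k j := fun w k => by
    simp [T, Matrix.mulVec, dotProduct, mul_comm]
  by_contra! hcon
  have hdisj : Disjoint (T '' stdSimplex ℝ κ) (Set.Iic 0) := by
    rw [Set.disjoint_left]
    rintro _ ⟨w, hw, rfl⟩ hle
    obtain ⟨k, hk⟩ := hcon w hw
    have h := hle k
    rw [hT] at h
    exact absurd h (not_le.mpr hk)
  -- If every image of the simplex had a positive entry, the image would miss the nonpositive
  -- orthant and could be strictly separated from it.
  obtain ⟨f, c, d, hf1, hcd, hf2⟩ := geometric_hahn_banach_compact_closed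
    ((convex_stdSimplex ℝ κ).linear_image T)
    ((isCompact_stdSimplex ℝ κ).image T.continuous_of_finiteDimensional)
    (convex_Iic 0) isClosed_Iic hdisj
  have hd : d < 0 := by simpa using hf2 0 (by simp)
  have hf : ∀ p : κ → ℝ, f p = ∑ k, p k * f (Pi.single k 1) := fun p => by
    conv_lhs => rw [pi_eq_sum_univ' p, map_sum]
    refine Finset.sum_congr rfl fun k _ => ?_
    rw [map_smul, smul_eq_mul]
  -- A positive coefficient would let `f` attain the value `d` itself on the orthant.
  have hneg : ∀ k, f (Pi.single k 1) ≤ 0 := fun k => by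
    by_contra! hk
    have h := hf2 ((d / f (Pi.single k 1)) • Pi.single k 1) (by
      intro j
      by_cases hj : j = k
      · subst hj
        simpa using div_nonpos_of_nonpos_of_nonneg hd.le hk.le
      · simp [hj])
    rw [map_smul, smul_eq_mul, div_mul_cancel₀ _ hk.ne'] at h
    exact lt_irrefl _ h
  have hcol : ∀ j, ∑ k, a k j * f (Pi.single k 1) < 0 := fun j => by
    have h := hf1 _ ⟨Pi.single j 1, single_mem_stdSimplex ℝ j, rfl⟩
    rw [hf] at h
    have h2 : ∀ k, T (Pi.single j 1) k = a k j := fun k => by simp [hT, Pi.single_apply]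
    simp only [h2] at h
    linarith
  -- The quadratic form of `a` at the coefficients of `f` sees only the symmetric part, and products
  -- of two coefficients are nonnegative. By `hneg` and `hcol` it is also a sum of nonnegative
  -- terms, so all coefficients vanish, against `hcol`.
  have hsum : ∑ j, ∑ k, f (Pi.single j 1) * (a k j * f (Pi.single k 1)) ≤ 0 := by
    have hsymm : ∑ j, ∑ k, f (Pi.single j 1) * (a k j * f (Pi.single k 1)) =
        ∑ j, ∑ k, f (Pi.single j 1) * (a j k * f (Pi.single k 1)) := by
      rw [Finset.sum_comm]
      exact Finset.sum_congr rfl fun _ _ => Finset.sum_congr rfl fun _ _ => by ring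
    have hadd : ∑ j, ∑ k, f (Pi.single j 1) * (a k j * f (Pi.single k 1)) +
        ∑ j, ∑ k, f (Pi.single j 1) * (a j k * f (Pi.single k 1)) ≤ 0 := by
      simp only [← Finset.sum_add_distrib]
      refine Finset.sum_nonpos fun j _ => Finset.sum_nonpos fun k _ => ?_
      have := mul_nonneg_of_nonpos_of_nonpos (hneg j) (hneg k)
      nlinarith [ha k j]
    linarith
  simp only [← Finset.mul_sum] at hsum
  have hnonneg : ∀ j, 0 ≤ f (Pi.single j 1) * ∑ k, a k j * f (Pi.single k 1) := fun j =>
    mul_nonneg_of_nonpos_of_nonpos (hneg j) (hcol j).le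
  have hzero : ∀ j, f (Pi.single j 1) = 0 := fun j => by
    have h := (Finset.sum_eq_zero_iff_of_nonneg fun j _ => hnonneg j).mp
      (le_antisymm hsum (Finset.sum_nonneg fun j _ => hnonneg j)) j (Finset.mem_univ j)
    exact (mul_eq_zero.mp h).resolve_right (hcol j).ne
  have h := hcol (Classical.arbitrary κ)
  simp [hzero] at h

/-- **Minty's lemma**: a weak solution of a variational inequality with continuous operator is a
solution. -/
theorem Convex.variational_le_of_minty {K : Set E} (hc : Convex ℝ K) {F : E → StrongDual ℝ E}
    (hF : ContinuousOn F K) {x : E} (hx : x ∈ K) (h : ∀ y ∈ K, F y (y - x) ≤ 0) :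
    ∀ y ∈ K, F x (y - x) ≤ 0 := by
  intro y hy
  -- The weak inequality is tested at points of the segment towards `y`; the factor `t` is divided
  -- out before `t → 0`.
  have hmaps : ∀ t ∈ Set.Ioc (0 : ℝ) 1, x + t • (y - x) ∈ K := fun t ht =>
    hc.add_smul_sub_mem hx hy ⟨ht.1.le, ht.2⟩
  have hpath : Filter.Tendsto (fun t : ℝ => x + t • (y - x)) (𝓝[Set.Ioc 0 1] 0) (𝓝[K] x) := by
    refine tendsto_nhdsWithin_iff.mpr ⟨?_, eventually_nhdsWithin_of_forall hmaps⟩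
    have hcont : Continuous fun t : ℝ => x + t • (y - x) := by fun_prop
    simpa using (hcont.tendsto 0).mono_left nhdsWithin_le_nhds
  have hlim : Filter.Tendsto (fun t : ℝ => F (x + t • (y - x)) (y - x)) (𝓝[Set.Ioc 0 1] 0)
      (𝓝 (F x (y - x))) :=
    ((ContinuousLinearMap.apply ℝ ℝ (y - x)).continuous.tendsto _).comp
      ((hF x hx).tendsto.comp hpath)
  have : (𝓝[Set.Ioc (0 : ℝ) 1] 0).NeBot := by
    rw [nhdsWithin_Ioc_eq_nhdsGT one_pos]
    infer_instance
  refine le_of_tendsto hlim (eventually_nhdsWithin_of_forall fun t ht => ?_)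
  have h1 := h _ (hmaps t ht)
  rw [add_sub_cancel_left, map_smul, smul_eq_mul] at h1
  exact nonpos_of_mul_nonpos_right h1 ht.1

/-- Existence of solutions of a variational inequality with a monotone continuous operator on a
compact convex set. -/
theorem IsCompact.exists_variational_le {K : Set E} (hK : IsCompact K) (hc : Convex ℝ K)
    (hne : K.Nonempty) {F : E → StrongDual ℝ E} (hF : ContinuousOn F K)
    (hmono : ∀ x ∈ K, ∀ y ∈ K, (F x - F y) (x - y) ≤ 0) :
    ∃ x ∈ K, ∀ y ∈ K, F x (y - x) ≤ 0 := by
  -- Freezing the operator at `y` makes each condition a closed half-space in `x`, so compactness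
  -- leaves only finitely many `y` to treat.
  have hfin : (K ∩ ⋂ y : K, {x | F y (y - x) ≤ 0}).Nonempty := by
    refine hK.inter_iInter_nonempty _
      (fun y => isClosed_le (by fun_prop) continuous_const) fun s => ?_
    rcases s.eq_empty_or_nonempty with rfl | hs
    · simpa using hne
    have : Nonempty s := hs.to_subtype
    -- Monotonicity is the sign condition on the symmetric part of this matrix; the weights define
    -- the convex combination sought.
    obtain ⟨w, hw, hle⟩ := exists_stdSimplex_sum_mul_nonpos
      (fun k j : s => F (k : K) ((k : K) - (j : K) : E)) fun k j => by
        have h := hmono _ (k : K).2 _ (j : K).2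
        have e : F (j : K) ((j : K) - (k : K) : E) = - F (j : K) ((k : K) - (j : K) : E) := by
          rw [← map_neg, neg_sub]
        rw [e]
        simpa [sub_eq_add_neg] using h
    refine ⟨∑ j : s, w j • ((j : K) : E), hc.sum_mem (fun j _ => hw.1 j) hw.2
      fun j _ => (j : K).2, Set.mem_iInter₂.mpr fun y hy => ?_⟩
    have h := hle ⟨y, hy⟩
    have e : (y : E) - ∑ j : s, w j • ((j : K) : E) = ∑ j : s, w j • ((y : E) - (j : K)) := by
      simp only [smul_sub, Finset.sum_sub_distrib]
      rw [← Finset.sum_smul, hw.2, one_smul]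
    change F y (y - ∑ j : s, w j • ((j : K) : E)) ≤ 0
    rw [e, map_sum]
    simpa using h
  obtain ⟨x, hx, hxy⟩ := hfin
  exact ⟨x, hx, hc.variational_le_of_minty hF hx fun y hy => Set.mem_iInter.mp hxy ⟨y, hy⟩⟩

/-- A concave function lies below its tangents. -/
theorem ConcaveOn.sub_le_of_hasFDerivWithinAt {S : Set E} {f : E → ℝ} (hf : ConcaveOn ℝ S f)
    {f' : StrongDual ℝ E} {x y : E} (hx : x ∈ S) (hy : y ∈ S) (h : HasFDerivWithinAt f f' S x) :
    f y - f x ≤ f' (y - x) := by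
  have hmaps : Set.MapsTo (AffineMap.lineMap x y : ℝ → E) (Set.Icc 0 1) S := fun t ht =>
    hf.1.lineMap_mem hx hy ht
  have hcomp : ConcaveOn ℝ (Set.Icc (0 : ℝ) 1) (f ∘ AffineMap.lineMap (k := ℝ) x y) :=
    (hf.comp_affineMap (AffineMap.lineMap x y)).subset hmaps (convex_Icc 0 1)
  have hderiv : HasDerivWithinAt (f ∘ AffineMap.lineMap (k := ℝ) x y) (f' (y - x))
      (Set.Icc (0 : ℝ) 1) 0 := by
    refine HasFDerivWithinAt.comp_hasDerivWithinAt (t := S) 0 ?_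
      AffineMap.hasDerivWithinAt_lineMap hmaps
    simpa using h
  simpa [slope_def_field] using
    hcomp.slope_le_of_hasDerivWithinAt (by simp) (by simp) one_pos hderiv

/-- An operator with negative definite derivatives on a convex set is strictly monotone. -/
theorem Convex.sub_apply_sub_neg_of_hasFDerivWithinAt {K : Set E} (hK : Convex ℝ K)
    {F : E → StrongDual ℝ E} {F' : E → E →L[ℝ] StrongDual ℝ E}
    (hF : ∀ x ∈ K, HasFDerivWithinAt F (F' x) K x)
    (hneg : ∀ x ∈ K, ∀ h, h ≠ 0 → F' x h h < 0) {x y : E} (hx : x ∈ K) (hy : y ∈ K)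
    (hxy : x ≠ y) : (F x - F y) (x - y) < 0 := by
  have hmaps : Set.MapsTo (AffineMap.lineMap y x : ℝ → E) (Set.Icc 0 1) K := fun t ht =>
    hK.lineMap_mem hy hx ht
  let g : ℝ → ℝ := fun t => F (AffineMap.lineMap y x t) (x - y)
  have hderiv : ∀ t ∈ Set.Icc (0 : ℝ) 1, HasDerivWithinAt g
      (F' (AffineMap.lineMap y x t) (x - y) (x - y)) (Set.Icc 0 1) t := fun t ht => by
    have h1 : HasDerivWithinAt (F ∘ AffineMap.lineMap (k := ℝ) y x)
        (F' (AffineMap.lineMap y x t) (x - y)) (Set.Icc (0 : ℝ) 1) t :=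
      (hF _ (hmaps ht)).comp_hasDerivWithinAt t AffineMap.hasDerivWithinAt_lineMap hmaps
    simpa [g] using h1.clm_apply (hasDerivWithinAt_const t _ (x - y))
  have hanti : StrictAntiOn g (Set.Icc 0 1) := by
    refine strictAntiOn_of_deriv_neg (convex_Icc 0 1)
      (fun t ht => (hderiv t ht).continuousWithinAt) fun t ht => ?_
    have ht' : t ∈ Set.Icc (0 : ℝ) 1 := interior_subset ht
    rw [((hderiv t ht').hasDerivAt (mem_interior_iff_mem_nhds.mp ht)).deriv]
    exact hneg _ (hmaps ht') _ (sub_ne_zero.mpr hxy)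
  have h := hanti (by simp) (by simp) (one_pos (α := ℝ))
  simpa [g] using h

/-- A negative definite bilinear form on a finite-dimensional space is coercive. -/
theorem ContinuousLinearMap.exists_apply_apply_le_neg_mul_sq [FiniteDimensional ℝ E]
    (B : E →L[ℝ] StrongDual ℝ E) (hB : ∀ h, h ≠ 0 → B h h < 0) :
    ∃ c > 0, ∀ h, B h h ≤ -c * ‖h‖ ^ 2 := by
  have : ProperSpace E := FiniteDimensional.proper_real E
  -- The sphere is empty when `E` is trivial; otherwise minus the maximum of the form on it is the
  -- constant.
  rcases (Metric.sphere (0 : E) 1).eq_empty_or_nonempty with hS | hS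
  · refine ⟨1, one_pos, fun h => ?_⟩
    have h0 : h = 0 := by
      by_contra hne
      have : ‖h‖⁻¹ • h ∈ Metric.sphere (0 : E) 1 := by
        simp [norm_smul, inv_mul_cancel₀ (norm_ne_zero_iff.mpr hne)]
      rw [hS] at this
      exact this
    simp [h0]
  · obtain ⟨z, hz, hmax⟩ := (isCompact_sphere (0 : E) 1).exists_isMaxOn hS
      (f := fun h => B h h) (by fun_prop)
    have hz0 : z ≠ 0 := by
      rintro rfl
      simp at hz
    refine ⟨-(B z z), neg_pos.mpr (hB z hz0), fun h => ?_⟩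
    by_cases hh : h = 0
    · simp [hh]
    have hn : ‖h‖ ≠ 0 := norm_ne_zero_iff.mpr hh
    have hmem : ‖h‖⁻¹ • h ∈ Metric.sphere (0 : E) 1 := by
      simp [norm_smul, inv_mul_cancel₀ hn]
    have hle : B (‖h‖⁻¹ • h) (‖h‖⁻¹ • h) ≤ B z z := hmax hmem
    have e : B h h = B (‖h‖⁻¹ • h) (‖h‖⁻¹ • h) * ‖h‖ ^ 2 := by
      simp only [map_smul, smul_apply, smul_eq_mul]
      field_simp
    rw [e, neg_neg]
    gcongr

/-- An operator with negative definite derivative at a point is strictly monotone around it. -/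
theorem HasFDerivWithinAt.eventually_sub_apply_sub_neg [FiniteDimensional ℝ E] {K : Set E}
    {F : E → StrongDual ℝ E} {F' : E →L[ℝ] StrongDual ℝ E} {x : E}
    (hF : HasFDerivWithinAt F F' K x) (hneg : ∀ h, h ≠ 0 → F' h h < 0) :
    ∀ᶠ y in 𝓝[K] x, y ≠ x → (F y - F x) (y - x) < 0 := by
  obtain ⟨c, hc, hle⟩ := F'.exists_apply_apply_le_neg_mul_sq hneg
  -- A remainder of at most `c / 2 * ‖y - x‖` uses up only half of the coercivity.
  filter_upwards [hF.isLittleO.def (half_pos hc)] with y hy hyx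
  have hpos : 0 < ‖y - x‖ := norm_pos_iff.mpr (sub_ne_zero.mpr hyx)
  have h1 := (le_abs_self _).trans ((F y - F x - F' (y - x)).le_opNorm (y - x))
  have h2 := hle (y - x)
  have h3 := mul_le_mul_of_nonneg_right hy hpos.le
  have h4 : (F y - F x) (y - x) = (F y - F x - F' (y - x)) (y - x) + F' (y - x) (y - x) := by
    simp
  nlinarith [mul_pos hc (mul_pos hpos hpos)]

end VariationalInequality
-- Geometry of the feasible sets of Hermitian matrices.
noncomputable section

/-- A convex set with nonempty interior has unique derivatives; in finite dimension this asks for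
full affine span, which is the linear span once `0 ∈ s`. -/
theorem Convex.uniqueDiffOn_of_span_eq_top {E : Type*} [NormedAddCommGroup E] [NormedSpace ℝ E]
    [FiniteDimensional ℝ E] {s : Set E} (hs : Convex ℝ s) (h0 : 0 ∈ s)
    (hspan : Submodule.span ℝ s = ⊤) : UniqueDiffOn ℝ s := by
  refine uniqueDiffOn_convex hs (hs.interior_nonempty_iff_affineSpan_eq_top.mpr ?_)
  refine SetLike.coe_injective ?_
  rw [← Set.insert_eq_of_mem h0, affineSpan_insert_zero, hspan]
  rfl

namespace HermMat

variable {𝕜 : Type*} [RCLike 𝕜] {n : Type*} [Fintype n]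

/-- The underlying matrix, as a linear map. -/
def matLinear (𝕜 : Type*) [RCLike 𝕜] (n : Type*) : HermMat 𝕜 n →ₗ[ℝ] Matrix n n 𝕜 where
  toFun := mat
  map_add' := mat_add
  map_smul' := mat_smul

theorem continuous_mat : Continuous (mat : HermMat 𝕜 n → Matrix n n 𝕜) :=
  (matLinear 𝕜 n).continuous_of_finiteDimensional

/-- The trace of a Hermitian matrix, as a real linear form. -/
def traceLinear (𝕜 : Type*) [RCLike 𝕜] (n : Type*) [Fintype n] : HermMat 𝕜 n →ₗ[ℝ] ℝ where
  toFun X := RCLike.re X.mat.trace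
  map_add' X Y := by simp [mat_add, Matrix.trace_add]
  map_smul' r X := by simp [mat_smul, Matrix.trace_smul, RCLike.smul_re]

/-- The square of a Hermitian matrix. -/
def sq (X : HermMat 𝕜 n) : HermMat 𝕜 n :=
  ⟨X.mat * X.mat, by
    have h : (X.mat * X.mat).IsHermitian := by
      rw [Matrix.IsHermitian, Matrix.conjTranspose_mul, X.isHermitian]
    exact h⟩

theorem posSemidef_sq (X : HermMat 𝕜 n) : X.sq.mat.PosSemidef := by
  have h := Matrix.posSemidef_conjTranspose_mul_self X.mat
  rw [X.isHermitian] at h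
  exact h

theorem norm_sq_eq_re_trace (X : HermMat 𝕜 n) : ‖X‖ ^ 2 = RCLike.re (X.mat * X.mat).trace := by
  rw [← real_inner_self_eq_norm_sq, inner_def]

variable [DecidableEq n]

theorem nuclearNorm_eq_of_posSemidef {X : HermMat 𝕜 n} (hX : X.mat.PosSemidef) :
    X.nuclearNorm = traceLinear 𝕜 n X := by
  have h : traceLinear 𝕜 n X = RCLike.re X.mat.trace := rfl
  rw [h, X.isHermitian.trace_eq_sum_eigenvalues]
  simp only [nuclearNorm, map_sum, RCLike.ofReal_re]
  exact Finset.sum_congr rfl fun m _ => abs_of_nonneg (hX.eigenvalues_nonneg m)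

/-- In terms of eigenvalues, a sum of squares is at most the square of the sum of absolute values.
This bounds the feasible sets. -/
theorem norm_le_trace_of_posSemidef {X : HermMat 𝕜 n} (hX : X.mat.PosSemidef) :
    ‖X‖ ≤ traceLinear 𝕜 n X := by
  have hsq : ‖X‖ ^ 2 = ∑ m, X.isHermitian.eigenvalues m ^ 2 := by
    rw [norm_sq_eq_re_trace]
    conv_lhs => rw [X.isHermitian.spectral_theorem, ← map_mul]
    simp only [Unitary.conjStarAlgAut_apply, Matrix.diagonal_mul_diagonal]
    rw [Matrix.trace_mul_cycle, Unitary.coe_star_mul_self, one_mul, Matrix.trace_diagonal]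
    simp [pow_two]
  rw [← nuclearNorm_eq_of_posSemidef hX]
  refine le_of_sq_le_sq ?_ (Finset.sum_nonneg fun _ _ => abs_nonneg _)
  rw [hsq]
  simpa [nuclearNorm] using Finset.sum_sq_le_sq_sum_of_nonneg (s := Finset.univ) fun m _ => abs_nonneg (X.isHermitian.eigenvalues m)

end HermMat

namespace SemidefGame

variable {𝕜 : Type*} [RCLike 𝕜] {m : Type*} [Fintype m] [DecidableEq m]

/-- On the semidefinite cone the norm bound becomes linear, which makes convexity and closedness
direct. -/
theorem mem_feasible_iff {A : ℝ} {X : HermMat 𝕜 m} :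
    X ∈ feasible 𝕜 m A ↔ X.mat.PosSemidef ∧ HermMat.traceLinear 𝕜 m X ≤ A :=
  and_congr_right fun h => by rw [HermMat.nuclearNorm_eq_of_posSemidef h]

theorem convex_feasible (A : ℝ) : Convex ℝ (feasible 𝕜 m A) := by
  intro X hX Y hY a b ha hb hab
  rw [mem_feasible_iff] at *
  refine ⟨(hX.1.smul ha).add (hY.1.smul hb), ?_⟩
  rw [map_add, map_smul, map_smul, smul_eq_mul, smul_eq_mul]
  calc _ ≤ a * A + b * A := by gcongr <;> [exact hX.2; exact hY.2]
    _ = A := by rw [← add_mul, hab, one_mul]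

theorem isCompact_feasible (A : ℝ) : IsCompact (feasible 𝕜 m A) := by
  have : ProperSpace (HermMat 𝕜 m) := FiniteDimensional.proper_real _
  refine Metric.isCompact_of_isClosed_isBounded ?_ ?_
  · have h : feasible 𝕜 m A = {X | ∀ v : m → 𝕜, 0 ≤ star v ⬝ᵥ X.mat.mulVec v} ∩
        {X | HermMat.traceLinear 𝕜 m X ≤ A} := by
      ext X
      rw [mem_feasible_iff, Matrix.posSemidef_iff_dotProduct_mulVec]
      simp [X.isHermitian]
    rw [h]
    refine IsClosed.inter ?_ (isClosed_le
      (LinearMap.continuous_of_finiteDimensional _) continuous_const)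
    simp only [Set.ofPred_forall]
    refine isClosed_iInter fun v => isClosed_le continuous_const ?_
    exact continuous_const.dotProduct (HermMat.continuous_mat.matrix_mulVec continuous_const)
  · refine (Metric.isBounded_closedBall (x := (0 : HermMat 𝕜 m)) (r := A)).subset fun X hX => ?_
    rw [mem_feasible_iff] at hX
    rw [mem_closedBall_zero_iff]
    exact (HermMat.norm_le_trace_of_posSemidef hX.1).trans hX.2

theorem zero_mem_feasible {A : ℝ} (hA : 0 ≤ A) : (0 : HermMat 𝕜 m) ∈ feasible 𝕜 m A := by
  rw [mem_feasible_iff, map_zero]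
  exact ⟨Matrix.PosSemidef.zero, hA⟩

theorem mem_span_feasible_of_posSemidef {A : ℝ} (hA : 0 < A) {X : HermMat 𝕜 m}
    (hX : X.mat.PosSemidef) : X ∈ Submodule.span ℝ (feasible 𝕜 m A) := by
  -- The summand 1 keeps the denominator positive when the trace is zero.
  set s : ℝ := A / (1 + HermMat.traceLinear 𝕜 m X) with hs
  have htr : 0 ≤ HermMat.traceLinear 𝕜 m X :=
    (norm_nonneg X).trans (HermMat.norm_le_trace_of_posSemidef hX)
  have hspos : 0 < s := by positivity
  have hmem : s • X ∈ feasible 𝕜 m A := by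
    rw [mem_feasible_iff, map_smul, smul_eq_mul]
    refine ⟨hX.smul hspos.le, ?_⟩
    rw [hs, div_mul_eq_mul_div, div_le_iff₀ (by positivity)]
    nlinarith
  have h := Submodule.smul_mem _ s⁻¹ (Submodule.subset_span (R := ℝ) hmem)
  rwa [inv_smul_smul₀ hspos.ne'] at h

/-- Polarization, `4X = (X + 1)² - (X - 1)²`, writes every Hermitian matrix through semidefinite
ones. -/
theorem span_feasible {A : ℝ} (hA : 0 < A) : Submodule.span ℝ (feasible 𝕜 m A) = ⊤ := by
  refine eq_top_iff.mpr fun X _ => ?_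
  let I : HermMat 𝕜 m := ⟨1, (Matrix.isHermitian_one : (1 : Matrix m m 𝕜).IsHermitian)⟩
  have hpos : ∀ Y : HermMat 𝕜 m, Y.sq ∈ Submodule.span ℝ (feasible 𝕜 m A) := fun Y =>
    mem_span_feasible_of_posSemidef hA Y.posSemidef_sq
  have e : X = (4⁻¹ : ℝ) • ((X + I).sq - (X - I).sq) := by
    refine HermMat.ext_mat ?_
    change X.mat = (4⁻¹ : ℝ) • ((X.mat + 1) * (X.mat + 1) - (X.mat - 1) * (X.mat - 1))
    have h : (X.mat + 1) * (X.mat + 1) - (X.mat - 1) * (X.mat - 1) = (4 : ℝ) • X.mat := by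
      have h4 : (4 : ℝ) • X.mat = X.mat + X.mat + (X.mat + X.mat) := by
        rw [← two_smul ℝ, ← two_smul ℝ, smul_smul]
        norm_num
      rw [h4]
      noncomm_ring
    rw [h, inv_smul_smul₀ (by norm_num)]
  rw [e]
  exact Submodule.smul_mem _ _ (Submodule.sub_mem _ (hpos _) (hpos _))

theorem uniqueDiffOn_feasible {A : ℝ} (hA : 0 < A) : UniqueDiffOn ℝ (feasible 𝕜 m A) :=
  Convex.uniqueDiffOn_of_span_eq_top (E := HermMat 𝕜 m) (convex_feasible A)
    (zero_mem_feasible hA.le) (span_feasible hA)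

end SemidefGame
-- The game as a variational inequality.
noncomputable section

namespace SemidefGame

variable {𝕜 : Type*} [RCLike 𝕜] {ι : Type*} [Fintype ι] [DecidableEq ι] {n : ι → Type*}
  [∀ i, Fintype (n i)] [∀ i, DecidableEq (n i)] {A : ι → ℝ} {u : ι → Profile 𝕜 n → ℝ}

omit [Fintype ι] [DecidableEq ι] in
theorem profiles_eq_pi (A : ι → ℝ) :
    profiles 𝕜 n A = Set.univ.pi fun i => feasible 𝕜 (n i) (A i) := by
  ext X
  simp [profiles]

omit [Fintype ι] [DecidableEq ι] in
theorem convex_profiles (A : ι → ℝ) : Convex ℝ (profiles 𝕜 n A) := by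
  rw [profiles_eq_pi]
  exact convex_pi fun i _ => convex_feasible (A i)

omit [Fintype ι] [DecidableEq ι] in
theorem isCompact_profiles (A : ι → ℝ) : IsCompact (profiles 𝕜 n A) := by
  rw [profiles_eq_pi]
  exact isCompact_univ_pi fun i => isCompact_feasible (A i)

omit [Fintype ι] in
theorem update_mem_profiles {X : Profile 𝕜 n} (hX : X ∈ profiles 𝕜 n A) (i : ι)
    {Y : HermMat 𝕜 (n i)} (hY : Y ∈ feasible 𝕜 (n i) (A i)) :
    Function.update X i Y ∈ profiles 𝕜 n A := by
  intro j
  by_cases h : j = i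
  · subst h
    simpa using hY
  · simpa [h] using hX j

/-- The linear map sending `V` to the linear form `H ↦ ⟪Hᵢ, V⟫`. -/
def innerProj (𝕜 : Type*) [RCLike 𝕜] {ι : Type*} [Fintype ι] (n : ι → Type*)
    [∀ i, Fintype (n i)] (i : ι) : HermMat 𝕜 (n i) →L[ℝ] StrongDual ℝ (Profile 𝕜 n) :=
  ((ContinuousLinearMap.compL ℝ (Profile 𝕜 n) (HermMat 𝕜 (n i)) ℝ).flip
    (ContinuousLinearMap.proj i)).comp (innerSL ℝ)

omit [DecidableEq ι] [∀ i, DecidableEq (n i)] in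
theorem innerProj_apply (i : ι) (V : HermMat 𝕜 (n i)) (H : Profile 𝕜 n) :
    innerProj 𝕜 n i V H = ⟪H i, V⟫_ℝ := by
  simp [innerProj, real_inner_comm]

/-- The linear form `H ↦ ∑ᵢ ⟪Hᵢ, Vᵢ(X)⟫` given by the payoff gradients at `X`. -/
def gradForm (A : ι → ℝ) (u : ι → Profile 𝕜 n → ℝ) (X : Profile 𝕜 n) :
    StrongDual ℝ (Profile 𝕜 n) :=
  ∑ i, innerProj 𝕜 n i (payoffGrad A u i X)

theorem gradForm_apply (X H : Profile 𝕜 n) :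
    gradForm A u X H = ∑ i, ⟪H i, payoffGrad A u i X⟫_ℝ := by
  simp [gradForm, innerProj_apply]

theorem stabilityPairing_eq (Xs X : Profile 𝕜 n) :
    stabilityPairing A u Xs X = gradForm A u X (X - Xs) := by
  rw [gradForm_apply]
  rfl

/-- The derivative of `gradForm` within the feasible profiles. -/
def gradFormDeriv (A : ι → ℝ) (u : ι → Profile 𝕜 n → ℝ) (X : Profile 𝕜 n) :
    Profile 𝕜 n →L[ℝ] StrongDual ℝ (Profile 𝕜 n) :=
  ∑ i, (innerProj 𝕜 n i).comp (fderivWithin ℝ (payoffGrad A u i) (profiles 𝕜 n A) X)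

theorem gradFormDeriv_apply (X H K : Profile 𝕜 n) :
    gradFormDeriv A u X H K =
      ∑ i, ⟪K i, fderivWithin ℝ (payoffGrad A u i) (profiles 𝕜 n A) X H⟫_ℝ := by
  simp [gradFormDeriv, innerProj_apply]

namespace IsSmoothConcaveGame

variable (hgame : IsSmoothConcaveGame A u)
include hgame

theorem hasFDerivWithinAt_payoffGrad {X : Profile 𝕜 n} (hX : X ∈ profiles 𝕜 n A) (i : ι) :
    HasFDerivWithinAt (payoffGrad A u i)
      (fderivWithin ℝ (payoffGrad A u i) (profiles 𝕜 n A) X) (profiles 𝕜 n A) X :=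
  ((hgame.contDiff i).differentiableOn one_ne_zero X hX).hasFDerivWithinAt

theorem hasFDerivWithinAt_gradForm {X : Profile 𝕜 n} (hX : X ∈ profiles 𝕜 n A) :
    HasFDerivWithinAt (gradForm A u) (gradFormDeriv A u X) (profiles 𝕜 n A) X := by
  have h (i : ι) : HasFDerivWithinAt (fun Y => innerProj 𝕜 n i (payoffGrad A u i Y))
      ((innerProj 𝕜 n i).comp (fderivWithin ℝ (payoffGrad A u i) (profiles 𝕜 n A) X))
      (profiles 𝕜 n A) X :=
    HasFDerivAt.comp_hasFDerivWithinAt (E := Profile 𝕜 n) (F := HermMat 𝕜 (n i))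
      (G := StrongDual ℝ (Profile 𝕜 n)) X (innerProj 𝕜 n i).hasFDerivAt
      (hgame.hasFDerivWithinAt_payoffGrad hX i)
  have hsum := HasFDerivWithinAt.fun_sum (𝕜 := ℝ) (E := Profile 𝕜 n)
    (F := StrongDual ℝ (Profile 𝕜 n))
    (u := Finset.univ) (A := fun i Y => innerProj 𝕜 n i (payoffGrad A u i Y))
    (A' := fun i => (innerProj 𝕜 n i).comp
      (fderivWithin ℝ (payoffGrad A u i) (profiles 𝕜 n A) X))
    (s := profiles 𝕜 n A) (x := X)
  exact hsum fun i _ => h i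

/-- Chain rule along `Function.update`. The block is a derivative within one player's feasible set,
so identifying it needs unique differentiability there. -/
theorem gradDeriv_apply {X : Profile 𝕜 n} (hX : X ∈ profiles 𝕜 n A) (i j : ι)
    (H : HermMat 𝕜 (n j)) :
    gradDeriv A u i j X H =
      fderivWithin ℝ (payoffGrad A u i) (profiles 𝕜 n A) X (Pi.single j H) := by
  have hV := hgame.hasFDerivWithinAt_payoffGrad hX i
  rw [← Function.update_eq_self j X] at hV
  have h := hV.comp (X j) (hasFDerivAt_update X (X j)).hasFDerivWithinAt
    (s := feasible 𝕜 (n j) (A j)) fun Y hY => update_mem_profiles hX j hY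
  rw [gradDeriv]
  have h2 := h.fderivWithin (uniqueDiffOn_feasible (hgame.pos j) (X j) (hX j))
  rw [Function.update_eq_self] at h2
  refine (congrArg (fun T => T H) h2).trans ?_
  simp only [ContinuousLinearMap.comp_apply]
  congr 1
  ext k : 1
  by_cases hk : k = j
  · subst hk
    simp
  · simp [hk]

theorem sum_gradDeriv {X : Profile 𝕜 n} (hX : X ∈ profiles 𝕜 n A) (i : ι) (H : Profile 𝕜 n) :
    ∑ j, gradDeriv A u i j X (H j) =
      fderivWithin ℝ (payoffGrad A u i) (profiles 𝕜 n A) X H := by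
  simp only [hgame.gradDeriv_apply hX]
  rw [← map_sum, Finset.univ_sum_single]

/-- The quadratic form of the Hessian is that of the derivative of the payoff gradients. -/
theorem sum_inner_hessianBlock {X : Profile 𝕜 n} (hX : X ∈ profiles 𝕜 n A) (H : Profile 𝕜 n) :
    ∑ i, ∑ j, ⟪H i, hessianBlock A u i j X (H j)⟫_ℝ = gradFormDeriv A u X H H := by
  -- The adjoint half of the Hessian contributes the same double sum as the other half, with the
  -- indices exchanged.
  have hswap : ∑ i, ∑ j, ⟪gradDeriv A u j i X (H i), H j⟫_ℝ =
      ∑ i, ∑ j, ⟪H i, gradDeriv A u i j X (H j)⟫_ℝ := by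
    rw [Finset.sum_comm]
    exact Finset.sum_congr rfl fun i _ => Finset.sum_congr rfl fun j _ => real_inner_comm _ _
  have hD : gradFormDeriv A u X H H = ∑ i, ∑ j, ⟪H i, gradDeriv A u i j X (H j)⟫_ℝ := by
    rw [gradFormDeriv_apply]
    refine Finset.sum_congr rfl fun i _ => ?_
    rw [← hgame.sum_gradDeriv hX, inner_sum]
  simp only [hessianBlock, add_apply, smul_apply, inner_add_right, real_inner_smul_right,
    ContinuousLinearMap.adjoint_inner_right, Finset.sum_add_distrib, ← Finset.mul_sum]
  rw [hswap, hD]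
  ring

theorem gradFormDeriv_neg {X : Profile 𝕜 n} (hX : X ∈ profiles 𝕜 n A)
    (hneg : HessianNegDef A u X) (H : Profile 𝕜 n) (hH : H ≠ 0) :
    gradFormDeriv A u X H H < 0 := by
  rw [← hgame.sum_inner_hessianBlock hX]
  exact hneg H hH

theorem hasFDerivWithinAt_utility {X : Profile 𝕜 n} (hX : X ∈ profiles 𝕜 n A) (i : ι) :
    HasFDerivWithinAt (fun Y => u i (Function.update X i Y))
      (InnerProductSpace.toDual ℝ _ (payoffGrad A u i X)) (feasible 𝕜 (n i) (A i)) (X i) :=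
  (hgame.differentiable i X hX (X i) (hX i)).hasGradientWithinAt.hasFDerivWithinAt

/-- Nash equilibria are the solutions of the variational inequality of the payoff gradients. -/
theorem isNash_iff {X : Profile 𝕜 n} :
    IsNash A u X ↔ X ∈ profiles 𝕜 n A ∧ ∀ Y ∈ profiles 𝕜 n A, gradForm A u X (Y - X) ≤ 0 := by
  refine and_congr_right fun hX => ⟨fun h Y hY => ?_, fun h i Y hY => ?_⟩
  · rw [gradForm_apply]
    refine Finset.sum_nonpos fun i _ => ?_
    have hmax : IsMaxOn (fun Y => u i (Function.update X i Y)) (feasible 𝕜 (n i) (A i)) (X i) :=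
      fun Y hY => by simpa using h i Y hY
    have hle := hmax.localize.hasFDerivWithinAt_nonpos (hgame.hasFDerivWithinAt_utility hX i)
      (sub_mem_posTangentConeAt_of_segment_subset
        ((convex_feasible (A i)).segment_subset (hX i) (hY i)))
    rw [InnerProductSpace.toDual_apply_apply] at hle
    rwa [real_inner_comm]
  -- Testing the inequality on a deviation of player `i` alone leaves one term, which bounds the
  -- gain by concavity.
  · have hle := (hgame.concave i X hX).sub_le_of_hasFDerivWithinAt (hX i) hY
      (hgame.hasFDerivWithinAt_utility hX i)
    have hform := h _ (update_mem_profiles hX i hY)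
    rw [gradForm_apply, Finset.sum_eq_single i (fun j _ hj => by simp [hj]) (by simp)] at hform
    rw [InnerProductSpace.toDual_apply_apply, Function.update_eq_self] at hle
    rw [Pi.sub_apply, Function.update_self, real_inner_comm] at hform
    linarith

/-- If the payoff gradients are strictly monotone between a Nash equilibrium and `X`, then the
strict stability inequality holds at `X`. -/
theorem gradForm_sub_neg {Xs X : Profile 𝕜 n} (hXs : IsNash A u Xs) (hX : X ∈ profiles 𝕜 n A)
    (h : (gradForm A u X - gradForm A u Xs) (X - Xs) < 0) : gradForm A u X (X - Xs) < 0 := by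
  have hle := (hgame.isNash_iff.mp hXs).2 X hX
  rw [sub_apply] at h
  linarith

end IsSmoothConcaveGame

/-- The strict stability inequality excludes further Nash equilibria. -/
theorem IsNash.eq_of_gradForm_sub_neg (hgame : IsSmoothConcaveGame A u) {Xs X : Profile 𝕜 n}
    (hXs : Xs ∈ profiles 𝕜 n A) (hX : IsNash A u X)
    (h : X ≠ Xs → gradForm A u X (X - Xs) < 0) : X = Xs := by
  by_contra hne
  -- The equilibrium `X`, tested against `Xs`, gives the opposite sign.
  have hle := (hgame.isNash_iff.mp hX).2 Xs hXs
  have hlt := h hne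
  rw [← neg_sub, map_neg] at hle
  linarith

theorem VS.of_gradForm_sub_neg {Xs X : Profile 𝕜 n}
    (h : X ≠ Xs → gradForm A u X (X - Xs) < 0) : VS A u Xs X := by
  rw [VS, stabilityPairing_eq]
  by_cases hX : X = Xs
  · simp [hX]
  · exact ⟨(h hX).le, fun h0 => absurd h0 (h hX).ne⟩

end SemidefGame
end

theorem mainTheorem8 {𝕜 : Type*} [RCLike 𝕜] {ι : Type*} [Fintype ι] [DecidableEq ι]
    {n : ι → Type*} [∀ i, Fintype (n i)] [∀ i, DecidableEq (n i)]
    (A : ι → ℝ) (u : ι → SemidefGame.Profile 𝕜 n → ℝ)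
    (hgame : SemidefGame.IsSmoothConcaveGame A u) :
    ((∀ X ∈ SemidefGame.profiles 𝕜 n A, SemidefGame.HessianNegDef A u X) →
      ∃ Xs : SemidefGame.Profile 𝕜 n, SemidefGame.IsNash A u Xs ∧
        (∀ X, SemidefGame.IsNash A u X → X = Xs) ∧ SemidefGame.IsGloballyStable A u Xs) ∧
    (∀ Xs : SemidefGame.Profile 𝕜 n, SemidefGame.IsNash A u Xs →
      SemidefGame.HessianNegDef A u Xs →
        SemidefGame.IsLocallyStable A u Xs ∧ SemidefGame.IsIsolatedNash A u Xs) := by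
  open SemidefGame in
  refine ⟨fun hneg => ?_, fun Xs hXs hneg => ?_⟩
  · have hmono : ∀ X ∈ profiles 𝕜 n A, ∀ Y ∈ profiles 𝕜 n A, X ≠ Y →
        (gradForm A u X - gradForm A u Y) (X - Y) < 0 := fun X hX Y hY hXY =>
      Convex.sub_apply_sub_neg_of_hasFDerivWithinAt (E := Profile 𝕜 n) (convex_profiles A)
        (fun Z hZ => hgame.hasFDerivWithinAt_gradForm hZ)
        (fun Z hZ => hgame.gradFormDeriv_neg hZ (hneg Z hZ)) hX hY hXY
    obtain ⟨Xs, hXs, hle⟩ := IsCompact.exists_variational_le (E := Profile 𝕜 n)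
      (isCompact_profiles A) (convex_profiles A) ⟨0, fun i => zero_mem_feasible (hgame.pos i).le⟩
      (fun X hX => (hgame.hasFDerivWithinAt_gradForm hX).continuousWithinAt)
      (fun X hX Y hY => by
        by_cases hXY : X = Y
        · simp [hXY]
        · exact (hmono X hX Y hY hXY).le)
    have hnash : IsNash A u Xs := hgame.isNash_iff.mpr ⟨hXs, hle⟩
    have hlt : ∀ X ∈ profiles 𝕜 n A, X ≠ Xs → gradForm A u X (X - Xs) < 0 := fun X hX hne =>
      hgame.gradForm_sub_neg hnash hX (hmono X hX Xs hXs hne)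
    exact ⟨Xs, hnash, fun X hX => hX.eq_of_gradForm_sub_neg hgame hXs (hlt X hX.1),
      hXs, fun X hX => .of_gradForm_sub_neg (hlt X hX)⟩
  · have hlt : ∀ᶠ X in 𝓝[profiles 𝕜 n A] Xs, X ≠ Xs → gradForm A u X (X - Xs) < 0 := by
      filter_upwards [(hgame.hasFDerivWithinAt_gradForm hXs.1).eventually_sub_apply_sub_neg
        (hgame.gradFormDeriv_neg hXs.1 hneg), self_mem_nhdsWithin] with X h hX hne
      exact hgame.gradForm_sub_neg hXs hX (h hne)
    refine ⟨⟨hXs.1, hlt.mono fun X h => .of_gradForm_sub_neg h⟩, hXs, ?_⟩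
    -- Equilibria are feasible, so a relative neighbourhood in `profiles` is enough for isolation in
    -- the full space.
    filter_upwards [eventually_nhdsWithin_iff.mp hlt] with X h hX
    exact hX.eq_of_gradForm_sub_neg hgame hXs.1 (h hX.1)
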